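/- Let $\mathcal H,\mathcal H_1,\mathcal H_2$ be separable complex Hilbert spaces; $[\mathcal H,\mathcal H']$ denotes the bounded linear operators $\mathcal H\to\mathcal H'$ and $[\mathcal H]=[\mathcal H,\mathcal H]$. An operator measure in $\mathcal H$ is a map $\Sigma$ from the bounded Borel subsets of $\mathbb R$ to the nonnegative operators in $[\mathcal H]$ which is strongly countably additive and satisfies $\Sigma(\emptyset)=0$; $\Sigma^{ac}$ is the absolutely continuous part of $\Sigma$ in its Lebesgue decomposition with respect to Lebesgue measure $m$. Its distribution function is $\Sigma(t)=\Sigma([0,t))$ for $t>0$, $\Sigma(0)=0$, $\Sigma(t)=-\Sigma([t,0))$ for $t<0$. The measure $\Sigma$ is called equivalent to $m$ if $\Sigma(\delta)=0\Leftrightarrow m(\delta)=0$ for every bounded Borel set $\delta$. For $j\in\{1,2\}$ let $F_j:\mathbb C\setminus\mathbb R\to[\mathcal H_j]$ be a Nevanlinna function, that is, holomorphic with $\operatorname{Im}z\cdot\operatorname{Im}F_j(z)\ge 0$ and $F_j(z)^*=F_j(\overline z)$, and let $\Sigma_j$, $C_j$, $D_j$ be its spectral measure and parameters: $$F_j(z)=C_j+D_jz+\int_{\mathbb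 R}\Bigl(\frac1{t-z}-\frac{t}{1+t^2}\Bigr)\,d\Sigma_j(t),\qquad z\in\mathbb C\setminus\mathbb R,$$ where $C_j=C_j^*\in[\mathcal H_j]$, $0\le D_j\in[\mathcal H_j]$, $\Sigma_j$ is an operator measure in $\mathcal H_j$ with $\int_{\mathbb R}(1+t^2)^{-1}d\Sigma_j(t)\in[\mathcal H_j]$, and the integrals are understood in the strong sense. Let $B_j\in[\mathcal H_j]$, and let $K_j\in[\mathcal H,\mathcal H_j]$ be boundedly invertible. Put $$\Omega_\pm=\{z\in\mathbb C_\pm:\ B_1-F_1(z)\text{ and }B_2-F_2(z)\text{ are boundedly invertible}\},$$ $$\widetilde\Sigma_j(\delta)=K_j^{-1}\Sigma_j(\delta)K_j^{-1*},\quad \widetilde B_j=K_j^{-1}B_jK_j^{-1*},\quad \widetilde C_j=K_j^{-1}C_jK_j^{-1*},\quad \widetilde D_j=K_j^{-1}D_jK_j^{-1*}.$$ Suppose that $\Omega_+\neq\emptyset$ and that $$K_1^*(B_1-F_1(z))^{-1}K_1=K_2^*(B_2-F_2(z))^{-1}K_2\qquad(\ast)$$ for all $z\in\Omega_+$. Assume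 in addition that at least one of the following conditions holds: (i) neither $\Sigma_1^{ac}$ nor $\Sigma_2^{ac}$ is equivalent to $m$; (ii) $\Omega_-\neq\emptyset$ and $(\ast)$ also holds for all $z\in\Omega_-$; (iii) for some $t_0\in\mathbb R$ the weak derivatives at $t_0$ of the distribution functions of $\widetilde\Sigma_1$ and $\widetilde\Sigma_2$ exist as operators in $[\mathcal H]$ and are equal (existence is the same as existence of the weak derivatives of $\Sigma_1(t)$ and $\Sigma_2(t)$ at $t_0$; for $K_1=K_2$ the equality is that of these derivatives as well). Then $$\widetilde\Sigma_1=\widetilde\Sigma_2,\qquad \operatorname{Im}\widetilde B_1=\operatorname{Im}\widetilde B_2,\qquad \widetilde C_1-\operatorname{Re}\widetilde B_1=\widetilde C_2-\operatorname{Re}\widetilde B_2,\qquad \widetilde D_1=\widetilde D_2 .$$ -/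

import Mathlib

open MeasureTheory Filter Topology Set
open scoped ComplexStarModule

/-- The open upper half-plane. -/
def upperHalf : Set ℂ := {z | 0 < z.im}

/-- The open lower half-plane. -/
def lowerHalf : Set ℂ := {z | z.im < 0}

section OperatorMeasures

variable {H : Type*} [NormedAddCommGroup H] [InnerProductSpace ℂ H] [CompleteSpace H]
variable {G : Type*} [NormedAddCommGroup G] [InnerProductSpace ℂ G] [CompleteSpace G]

/-- An operator measure on the ring of bounded Borel subsets of the real line: it vanishes on the
empty set, its values are nonnegative (in particular self-adjoint) bounded operators, and it is
strongly countably additive. The values of `toFun` on other sets carry no information. -/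
structure OperatorMeasure (H : Type*) [NormedAddCommGroup H] [InnerProductSpace ℂ H]
    [CompleteSpace H] where
  toFun : Set ℝ → H →L[ℂ] H
  map_empty : toFun ∅ = 0
  positive : ∀ δ : Set ℝ, MeasurableSet δ → Bornology.IsBounded δ → (toFun δ).IsPositive
  hasSum : ∀ δ : ℕ → Set ℝ, (∀ i, MeasurableSet (δ i)) → Pairwise (Function.onFun Disjoint δ) →
    Bornology.IsBounded (⋃ i, δ i) → ∀ h : H, HasSum (fun i => toFun (δ i) h) (toFun (⋃ i, δ i) h)

namespace OperatorMeasure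

/-- Two operator measures are the same when they agree on all bounded Borel sets. -/
def Same (S T : OperatorMeasure H) : Prop :=
  ∀ δ : Set ℝ, MeasurableSet δ → Bornology.IsBounded δ → S.toFun δ = T.toFun δ

/-- The restriction `δ ↦ S (δ ∩ N)` of an operator measure to a Borel set `N`. -/
def restrict (S : OperatorMeasure H) (N : Set ℝ) (hN : MeasurableSet N) : OperatorMeasure H where
  toFun δ := S.toFun (δ ∩ N)
  map_empty := by simp [S.map_empty]
  positive δ hδ hb := S.positive _ (hδ.inter hN) (hb.subset inter_subset_left)
  hasSum δ hδ hd hb h := by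
    have := S.hasSum (fun i => δ i ∩ N) (fun i => (hδ i).inter hN)
      (fun i j hij => (hd hij).mono inter_subset_left inter_subset_left)
      (by rw [← iUnion_inter]; exact hb.subset inter_subset_left) h
    rwa [← iUnion_inter] at this

/-- The operator measure `δ ↦ T S(δ) T*`. -/
noncomputable def conj (S : OperatorMeasure H) (T : H →L[ℂ] G) : OperatorMeasure G where
  toFun δ := T ∘L S.toFun δ ∘L ContinuousLinearMap.adjoint T
  map_empty := by ext; simp [S.map_empty]
  positive δ hδ hb := (S.positive δ hδ hb).conj_adjoint T
  hasSum δ hδ hd hb g := (S.hasSum δ hδ hd hb (ContinuousLinearMap.adjoint T g)).mapL T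

/-- Absolute continuity with respect to Lebesgue measure. -/
def AbsContLebesgue (S : OperatorMeasure H) : Prop :=
  ∀ δ : Set ℝ, MeasurableSet δ → Bornology.IsBounded δ → volume δ = 0 → S.toFun δ = 0

/-- Singularity with respect to Lebesgue measure. -/
def SingularLebesgue (S : OperatorMeasure H) : Prop :=
  ∃ N : Set ℝ, MeasurableSet N ∧ volume N = 0 ∧
    ∀ δ : Set ℝ, MeasurableSet δ → Bornology.IsBounded δ → S.toFun δ = S.toFun (δ ∩ N)

/-- Equivalence with Lebesgue measure: the same bounded Borel null sets. -/
def EquivLebesgue (S : OperatorMeasure H) : Prop :=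
  ∀ δ : Set ℝ, MeasurableSet δ → Bornology.IsBounded δ → (S.toFun δ = 0 ↔ volume δ = 0)

/-- For one vector and one bounded window, some Lebesgue null set carries the singular part of
the scalar measure. -/
theorem exists_null_set_aux (S : OperatorMeasure H) (h : H) (n : ℕ) :
    ∃ N : Set ℝ, MeasurableSet N ∧ volume N = 0 ∧ ∀ δ : Set ℝ, MeasurableSet δ →
      δ ⊆ Icc (-(n : ℝ)) n → volume δ = 0 → inner ℂ (S.toFun (δ \ N) h) h = 0 := by
  classical
  have hbd : ∀ δ : Set ℝ, Bornology.IsBounded (δ ∩ Icc (-(n : ℝ)) n) := fun δ =>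
    (Metric.isBounded_Icc _ _).subset inter_subset_right
  have hnn : ∀ δ : Set ℝ, MeasurableSet δ →
      0 ≤ (inner ℂ (S.toFun (δ ∩ Icc (-(n : ℝ)) n) h) h).re := fun δ hδ =>
    (S.positive _ (hδ.inter measurableSet_Icc) (hbd δ)).re_inner_nonneg_left h
  let μ : Measure ℝ := Measure.ofMeasurable
    (fun δ _ => ENNReal.ofReal (inner ℂ (S.toFun (δ ∩ Icc (-(n : ℝ)) n) h) h).re)
    (by simp [S.map_empty])
    (by
      intro δ hδ hd
      have h2 := S.hasSum (fun i => δ i ∩ Icc (-(n : ℝ)) n)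
        (fun i => (hδ i).inter measurableSet_Icc)
        (fun i j hij => (hd hij).mono inter_subset_left inter_subset_left)
        (by rw [← iUnion_inter]; exact hbd _) h
      rw [← iUnion_inter] at h2
      have h3 := (h2.mapL ((innerSL ℂ) h))
      have h4 := h3.mapL Complex.reCLM
      have h5 : HasSum (fun i => (inner ℂ (S.toFun (δ i ∩ Icc (-(n : ℝ)) n) h) h).re)
          (inner ℂ (S.toFun ((⋃ i, δ i) ∩ Icc (-(n : ℝ)) n) h) h).re := by
        convert h4 using 1
        · ext i
          exact inner_re_symm (𝕜 := ℂ) _ _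
        · exact inner_re_symm (𝕜 := ℂ) _ _
      rw [← h5.tsum_eq]
      exact ENNReal.ofReal_tsum_of_nonneg (fun i => hnn _ (hδ i)) h5.summable)
  have hμ : ∀ δ : Set ℝ, MeasurableSet δ →
      μ δ = ENNReal.ofReal (inner ℂ (S.toFun (δ ∩ Icc (-(n : ℝ)) n) h) h).re := fun δ hδ =>
    Measure.ofMeasurable_apply δ hδ
  have : IsFiniteMeasure μ := ⟨by rw [hμ _ MeasurableSet.univ]; exact ENNReal.ofReal_lt_top⟩
  have hs := Measure.mutuallySingular_singularPart μ (volume : Measure ℝ)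
  refine ⟨hs.nullSetᶜ, hs.measurableSet_nullSet.compl, hs.measure_compl_nullSet, ?_⟩
  intro δ hδ hsub h0
  have hm : MeasurableSet (δ \ hs.nullSetᶜ) := hδ.diff hs.measurableSet_nullSet.compl
  have hz : μ (δ \ hs.nullSetᶜ) = 0 := by
    have hadd := congrArg (fun ν : Measure ℝ => ν (δ \ hs.nullSetᶜ))
      (Measure.haveLebesgueDecomposition_add μ (volume : Measure ℝ))
    refine hadd.trans ?_
    rw [Measure.add_apply, add_eq_zero]
    constructor
    · exact measure_mono_null (fun x hx => by simpa using hx.2) hs.measure_nullSet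
    · exact withDensity_absolutelyContinuous _ _ (measure_mono_null sdiff_subset h0)
  rw [hμ _ hm, inter_eq_left.2 (sdiff_subset.trans hsub), ENNReal.ofReal_eq_zero] at hz
  have hpos := S.positive _ hm ((Metric.isBounded_Icc _ _).subset (sdiff_subset.trans hsub))
  have h6 := hpos.inner_nonneg_left h
  rw [Complex.le_def] at h6
  exact Complex.ext (le_antisymm hz (by simpa using h6.1)) (by simpa using h6.2.symm)

/-- Some Lebesgue null set carries the singular part of an operator measure in a separable space. -/
theorem exists_null_set [TopologicalSpace.SeparableSpace H] (S : OperatorMeasure H) :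
    ∃ N : Set ℝ, MeasurableSet N ∧ volume N = 0 ∧ ∀ δ : Set ℝ, MeasurableSet δ →
      Bornology.IsBounded δ → volume δ = 0 → S.toFun (δ \ N) = 0 := by
  choose N hNm hN0 hN using fun p : ℕ × ℕ =>
    S.exists_null_set_aux (TopologicalSpace.denseSeq H p.1) p.2
  have hm : MeasurableSet (⋃ p, N p) := MeasurableSet.iUnion hNm
  refine ⟨⋃ p, N p, hm, measure_iUnion_null hN0, ?_⟩
  intro δ hδ hb h0
  obtain ⟨n, hn⟩ : ∃ n : ℕ, δ ⊆ Icc (-(n : ℝ)) n := by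
    obtain ⟨r, hr⟩ := hb.subset_closedBall 0
    obtain ⟨n, hn⟩ := exists_nat_ge r
    refine ⟨n, fun x hx => ?_⟩
    have := hr hx
    rw [Metric.mem_closedBall, Real.dist_0_eq_abs] at this
    exact abs_le.1 (this.trans hn)
  have key : ∀ h : H, inner ℂ (S.toFun (δ \ ⋃ p, N p) h) h = 0 := by
    intro h
    refine congrFun (Continuous.ext_on (TopologicalSpace.denseRange_denseSeq H)
      (f := fun h => inner ℂ (S.toFun (δ \ ⋃ p, N p) h) h) (g := fun _ => (0 : ℂ))
      (by fun_prop) continuous_const ?_) h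
    rintro _ ⟨k, rfl⟩
    have h1 := hN (k, n) (δ \ ⋃ p, N p) (hδ.diff hm) (sdiff_subset.trans hn)
      (measure_mono_null sdiff_subset h0)
    rwa [sdiff_sdiff, union_eq_left.2 (subset_iUnion N (k, n))] at h1
  have := (inner_map_self_eq_zero (S.toFun (δ \ ⋃ p, N p) : H →ₗ[ℂ] H)).1 key
  ext x
  exact congrArg (fun f => f x) this

/-- A Lebesgue null set that carries the singular part. -/
noncomputable def singularSet [TopologicalSpace.SeparableSpace H] (S : OperatorMeasure H) :
    Set ℝ := S.exists_null_set.choose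

theorem measurableSet_singularSet [TopologicalSpace.SeparableSpace H] (S : OperatorMeasure H) :
    MeasurableSet S.singularSet := S.exists_null_set.choose_spec.1

/-- The absolutely continuous part in the Lebesgue decomposition. -/
noncomputable def acPart [TopologicalSpace.SeparableSpace H] (S : OperatorMeasure H) :
    OperatorMeasure H := S.restrict S.singularSetᶜ S.measurableSet_singularSet.compl

/-- The singular part in the Lebesgue decomposition. -/
noncomputable def singularPart [TopologicalSpace.SeparableSpace H] (S : OperatorMeasure H) :
    OperatorMeasure H := S.restrict S.singularSet S.measurableSet_singularSet

theorem absCont_acPart [TopologicalSpace.SeparableSpace H] (S : OperatorMeasure H) :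
    S.acPart.AbsContLebesgue := fun δ hδ hb h0 =>
  S.exists_null_set.choose_spec.2.2 δ hδ hb h0

theorem singular_singularPart [TopologicalSpace.SeparableSpace H] (S : OperatorMeasure H) :
    S.singularPart.SingularLebesgue :=
  ⟨S.singularSet, S.measurableSet_singularSet, S.exists_null_set.choose_spec.2.1,
    fun δ _ _ => by simp [singularPart, restrict, inter_assoc]⟩

/-- Finite additivity. -/
theorem union_disjoint (S : OperatorMeasure H) {α β : Set ℝ} (hα : MeasurableSet α)
    (hβ : MeasurableSet β) (hd : Disjoint α β) (hb : Bornology.IsBounded (α ∪ β)) :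
    S.toFun (α ∪ β) = S.toFun α + S.toFun β := by
  ext h
  let u : ℕ → Set ℝ := fun i => if i = 0 then α else if i = 1 then β else ∅
  have hu : (⋃ i, u i) = α ∪ β := by
    ext x
    simp only [mem_iUnion, mem_union]
    constructor
    · rintro ⟨i, hi⟩
      rcases i with _ | _ | i
      · exact Or.inl hi
      · exact Or.inr hi
      · simp [u] at hi
    · rintro (hx | hx)
      · exact ⟨0, hx⟩
      · exact ⟨1, hx⟩
  have hum : ∀ i, MeasurableSet (u i) := by
    intro i
    rcases i with _ | _ | i
    · exact hα
    · exact hβ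
    · simp [u]
  have hud : Pairwise (Function.onFun Disjoint u) := by
    intro i j hij
    rcases i with _ | _ | i <;> rcases j with _ | _ | j <;>
      simp [u, Function.onFun, hd, hd.symm] at hij ⊢
  have h1 := S.hasSum u hum hud (by rwa [hu]) h
  rw [hu] at h1
  have h2 : HasSum (fun i => S.toFun (u i) h) (∑ i ∈ Finset.range 2, S.toFun (u i) h) := by
    refine hasSum_sum_of_ne_finset_zero fun i hi => ?_
    rcases i with _ | _ | i
    · simp at hi
    · simp at hi
    · simp [u, S.map_empty]
  rw [h1.unique h2]
  simp [Finset.sum_range_succ, u]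

/-- The Lebesgue decomposition. -/
theorem acPart_add_singularPart [TopologicalSpace.SeparableSpace H] (S : OperatorMeasure H)
    (δ : Set ℝ) (hδ : MeasurableSet δ) (hb : Bornology.IsBounded δ) :
    S.toFun δ = S.acPart.toFun δ + S.singularPart.toFun δ := by
  have hs := S.measurableSet_singularSet
  have h := S.union_disjoint (hδ.inter hs.compl) (hδ.inter hs)
    (disjoint_compl_left.mono inter_subset_right inter_subset_right)
    (by rw [← inter_union_distrib_left]; exact hb.subset inter_subset_left)
  rw [← inter_union_distrib_left, compl_union_self, inter_univ] at h
  exact h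

open Classical in
/-- The normalized distribution function: `S [0,t)` for `t > 0`, `0` at `t = 0`, and `-S [t,0)`
for `t < 0`. -/
noncomputable def distribution (S : OperatorMeasure H) (t : ℝ) : H →L[ℂ] H :=
  if 0 < t then S.toFun (Ico 0 t) else if t < 0 then -S.toFun (Ico t 0) else 0

open Classical in
/-- The integral of a simple function over a Borel set `β` (bounded in all uses). -/
noncomputable def simpleIntegral (S : OperatorMeasure H) (β : Set ℝ) (s : SimpleFunc ℝ ℂ) :
    H →L[ℂ] H := ∑ c ∈ s.range, c • S.toFun (s ⁻¹' {c} ∩ β)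

/-- `T` is the integral of `f` over the bounded Borel set `β`: there are simple functions that
converge to `f` uniformly on `β` and whose integrals over `β` converge strongly to `T`. -/
def HasIntegralOn (S : OperatorMeasure H) (β : Set ℝ) (f : ℝ → ℂ) (T : H →L[ℂ] H) : Prop :=
  ∃ s : ℕ → SimpleFunc ℝ ℂ, TendstoUniformlyOn (fun k t => s k t) f atTop β ∧
    ∀ h : H, Tendsto (fun k => S.simpleIntegral β (s k) h) atTop (𝓝 (T h))

/-- `T` is the (improper) integral of `f` over the real line in the strong sense: the integrals
over `[a,b)` converge strongly to `T` as `a → -∞` and `b → ∞`. -/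
def HasStrongIntegral (S : OperatorMeasure H) (f : ℝ → ℂ) (T : H →L[ℂ] H) : Prop :=
  ∃ I : ℝ → ℝ → H →L[ℂ] H, (∀ a b, S.HasIntegralOn (Ico a b) f (I a b)) ∧
    ∀ h : H, Tendsto (fun p : ℝ × ℝ => I p.1 p.2 h) (atBot ×ˢ atTop) (𝓝 (T h))

end OperatorMeasure

/-- `T` is the weak derivative at `t₀` of the operator function `Φ`. -/
def HasWeakDerivAt (Φ : ℝ → H →L[ℂ] H) (T : H →L[ℂ] H) (t₀ : ℝ) : Prop :=
  ∀ g h : H, HasDerivAt (fun t => inner ℂ g (Φ t h)) (inner ℂ g (T h)) t₀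

/-- Nevanlinna functions; the values at real points carry no information. -/
structure IsRFunction (F : ℂ → H →L[ℂ] H) : Prop where
  holomorphic : DifferentiableOn ℂ F {z | z.im ≠ 0}
  im_nonneg : ∀ z : ℂ, z.im ≠ 0 → ((z.im : ℂ) • (ℑ (F z) : H →L[ℂ] H)).IsPositive
  symm : ∀ z : ℂ, z.im ≠ 0 → ContinuousLinearMap.adjoint (F z) = F (star z)

/-- `S` is the spectral measure and `C`, `D` are the parameters of the Nevanlinna function `F`:
`F(z) = C + D z + ∫ (1/(t-z) - t/(1+t²)) dS(t)` for all non-real `z`, with `C` self-adjoint,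
`D ≥ 0` and `∫ dS(t)/(1+t²)` a bounded operator. -/
structure IsSpectralData (F : ℂ → H →L[ℂ] H) (C D : H →L[ℂ] H) (S : OperatorMeasure H) :
    Prop where
  selfAdjoint : IsSelfAdjoint C
  positive : D.IsPositive
  integrable : ∃ T : H →L[ℂ] H, S.HasStrongIntegral (fun t => 1 / (1 + (t : ℂ) ^ 2)) T
  representation : ∀ z : ℂ, z.im ≠ 0 → S.HasStrongIntegral
    (fun t => 1 / ((t : ℂ) - z) - (t : ℂ) / (1 + (t : ℂ) ^ 2)) (F z - C - z • D)

/-- The operator `K⁻¹ T (K⁻¹)*`. -/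
noncomputable def pullBack (K : G ≃L[ℂ] H) (T : H →L[ℂ] H) : G →L[ℂ] G :=
  (K.symm : H →L[ℂ] G) ∘L T ∘L ContinuousLinearMap.adjoint (K.symm : H →L[ℂ] G)

/-- The operator measure `δ ↦ K⁻¹ S(δ) (K⁻¹)*`. -/
noncomputable def OperatorMeasure.pullBack (K : G ≃L[ℂ] H) (S : OperatorMeasure H) :
    OperatorMeasure G := S.conj (K.symm : H →L[ℂ] G)

/-- The transform `K* (B - F(z))⁻¹ K`; it is meaningful where `B - F(z)` is boundedly invertible. -/
noncomputable def weylTransform (F : ℂ → H →L[ℂ] H) (B : H →L[ℂ] H) (K : G ≃L[ℂ] H) (z : ℂ) :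
    G →L[ℂ] G :=
  ContinuousLinearMap.adjoint (K : G →L[ℂ] H) ∘L Ring.inverse (B - F z) ∘L (K : G →L[ℂ] H)

end OperatorMeasures

/-- The points of `P` at which both `B₁ - F₁(z)` and `B₂ - F₂(z)` are boundedly invertible. -/
def commonResolventPoints {H₁ H₂ : Type*}
    [NormedAddCommGroup H₁] [InnerProductSpace ℂ H₁] [CompleteSpace H₁]
    [NormedAddCommGroup H₂] [InnerProductSpace ℂ H₂] [CompleteSpace H₂]
    (P : Set ℂ) (F₁ : ℂ → H₁ →L[ℂ] H₁) (B₁ : H₁ →L[ℂ] H₁)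
    (F₂ : ℂ → H₂ →L[ℂ] H₂) (B₂ : H₂ →L[ℂ] H₂) : Set ℂ :=
  {z ∈ P | IsUnit (B₁ - F₁ z) ∧ IsUnit (B₂ - F₂ z)}

/-! Write `F̃_j = K_j⁻¹ F_j K_j⁻¹*`. Inverting (∗) on the nonempty open set `Ω₊` gives `F̃₁ - F̃₂ =
E` there, with `E = B̃₁ - B̃₂`; the identity theorem extends this to the whole upper half-plane
(`pullBack_sub_eq_on`). For a vector `h`, the imaginary parts of the two quadratic forms then differ
by the constant `Im ⟨h, E h⟩`. A constant is itself a Poisson integral, namely of a multiple of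
Lebesgue measure `m`, so Stieltjes inversion (`measure_eq_of_poisson_eq`) yields `Σ̃₁ - Σ̃₂ = π⁻¹
(Im E) m` in the sense of quadratic forms (`form_pullBack_sub_form_pullBack`). Each extra condition
forces `Im E = 0`. Under (i) each measure vanishes on a set of positive Lebesgue measure, where the
other is nonnegative, so `Im E` has both signs. Under (ii) the difference is the same `E` in the
lower half-plane, and the symmetry of the `F_j` gives `E* = E`. Under (iii) the distribution
functions differ by `t π⁻¹ Im E`, whose derivative vanishes at `t₀`. Once `Im E = 0`, the measures
agree, the integrals cancel, and `E = (C̃₁ - C̃₂) + z (D̃₁ - D̃₂)` for all `z` in the upper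
half-plane, which gives the remaining identities (`pullBack_spectralData_eq`). -/

/-! ### Poisson integrals and Stieltjes inversion for scalar measures. -/

section StieltjesInversion

/-- The Poisson integral of a compactly supported function in scaled coordinates. -/
theorem integral_mul_poisson_eq (f : ℝ → ℝ) (t : ℝ) {y : ℝ} (hy : 0 < y) :
    ∫ x, f x * (y / ((t - x) ^ 2 + y ^ 2)) = ∫ s, f (t + y * s) * (1 + s ^ 2)⁻¹ := by
  have h1 : ∫ s, f (t + y * s) * (1 + s ^ 2)⁻¹ =
      ∫ s, (fun x => f (t + x) * (1 + (x / y) ^ 2)⁻¹) (y * s) := by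
    refine integral_congr_ae (Eventually.of_forall fun s => ?_)
    simp only
    rw [mul_div_cancel_left₀ _ hy.ne']
  rw [h1, Measure.integral_comp_mul_left (fun x => f (t + x) * (1 + (x / y) ^ 2)⁻¹) y, abs_of_pos (inv_pos.2 hy), smul_eq_mul,
    ← integral_const_mul,
    ← integral_add_left_eq_self (fun x => f x * (y / ((t - x) ^ 2 + y ^ 2))) t]
  refine integral_congr_ae (Eventually.of_forall fun x => ?_)
  have : (0 : ℝ) < x ^ 2 + y ^ 2 := by positivity
  have h2 : (1 + (x / y) ^ 2)⁻¹ = y ^ 2 / (x ^ 2 + y ^ 2) := by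
    field_simp
    ring
  simp only
  rw [h2, show (t - (t + x)) ^ 2 = x ^ 2 by ring]
  field_simp

theorem continuous_poisson (t : ℝ) {y : ℝ} (hy : 0 < y) :
    Continuous fun x : ℝ => y / ((t - x) ^ 2 + y ^ 2) := by
  refine Continuous.div (by fun_prop) (by fun_prop) fun x => ?_
  positivity

/-- The Poisson kernel is an approximate identity of total mass `π`: after scaling, the integrand is
dominated by `M (1 + s²)⁻¹`. -/
theorem tendsto_integral_mul_poisson {f : ℝ → ℝ} (hf : Continuous f) {M : ℝ}
    (hM : ∀ x, ‖f x‖ ≤ M) (t : ℝ) {y : ℕ → ℝ} (hy : ∀ n, 0 < y n)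
    (hy0 : Tendsto y atTop (𝓝 0)) :
    Tendsto (fun n => ∫ x, f x * (y n / ((t - x) ^ 2 + y n ^ 2))) atTop (𝓝 (Real.pi * f t)) := by
  simp_rw [fun n => integral_mul_poisson_eq f t (hy n)]
  have : Real.pi * f t = ∫ s, f t * (1 + s ^ 2)⁻¹ := by
    rw [integral_const_mul, integral_univ_inv_one_add_sq, mul_comm]
  rw [this]
  refine tendsto_integral_of_dominated_convergence (fun s => M * (1 + s ^ 2)⁻¹) (fun n => ?_)
    (integrable_inv_one_add_sq.const_mul M) (fun n => Eventually.of_forall fun s => ?_)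
    (Eventually.of_forall fun s => ?_)
  · exact ((hf.comp (by fun_prop)).mul
      (Continuous.inv₀ (by fun_prop) fun s => by positivity)).aestronglyMeasurable
  · rw [norm_mul, Real.norm_of_nonneg (by positivity : (0 : ℝ) ≤ (1 + s ^ 2)⁻¹)]
    gcongr
    exact hM _
  · refine Tendsto.mul_const _ ((hf.tendsto t).comp ?_)
    simpa using (hy0.mul_const s).const_add t

/-- Supplies the dominating function for vague convergence. The bound is uniform in `y ≤ 1` and
decays like the weight against which spectral measures are finite. -/
theorem exists_bound_integral_mul_poisson {f : ℝ → ℝ} (hf : Continuous f)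
    (hc : HasCompactSupport f) (h0 : ∀ x, 0 ≤ f x) :
    ∃ C : ℝ, ∀ t y : ℝ, 0 < y → y ≤ 1 →
      ∫ x, f x * (y / ((t - x) ^ 2 + y ^ 2)) ≤ C * (1 + t ^ 2)⁻¹ := by
  obtain ⟨M, hM⟩ := hc.exists_bound_of_continuous hf
  have hM0 : 0 ≤ M := (norm_nonneg _).trans (hM 0)
  obtain ⟨R, hR1, hR⟩ : ∃ R : ℝ, 1 ≤ R ∧ ∀ x, f x ≠ 0 → |x| ≤ R := by
    obtain ⟨r, hr⟩ := hc.isCompact.isBounded.subset_closedBall 0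
    refine ⟨max r 1, le_max_right _ _, fun x hx => ?_⟩
    have := hr (subset_tsupport f hx)
    rw [Metric.mem_closedBall, Real.dist_0_eq_abs] at this
    exact this.trans (le_max_left _ _)
  have hI : 0 ≤ ∫ x, f x := integral_nonneg h0
  -- The first summand serves `|t| ≤ 2R`, where `1 + t² ≤ 1 + 4R²`. The second serves `|t| > 2R`:
  -- there `|t - x| ≥ |t|/2` on the support, so the kernel is at most `4/t²`, and `t² ≥ 1` (from `R
  -- ≥ 1`) gives `4(1 + t²)/t² ≤ 8`.
  refine ⟨M * Real.pi * (1 + 4 * R ^ 2) + 8 * ∫ x, f x, fun t y hy hy1 => ?_⟩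
  have ht : (0 : ℝ) < 1 + t ^ 2 := by positivity
  rw [← div_eq_mul_inv, le_div_iff₀ ht]
  have hint := (hf.mul (continuous_poisson t hy)).integrable_of_hasCompactSupport
    (μ := volume) hc.mul_right
  by_cases h : |t| ≤ 2 * R
  · have h1 : ∫ x, f x * (y / ((t - x) ^ 2 + y ^ 2)) ≤ M * Real.pi := by
      rw [integral_mul_poisson_eq f t hy, ← integral_univ_inv_one_add_sq, ← integral_const_mul]
      refine integral_mono_of_nonneg (Eventually.of_forall fun s => ?_)
        (integrable_inv_one_add_sq.const_mul M) (Eventually.of_forall fun s => ?_)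
      · exact mul_nonneg (h0 _) (by positivity)
      · simp only
        gcongr
        exact (le_abs_self _).trans (hM _)
    have h2 : t ^ 2 ≤ 4 * R ^ 2 := by
      have := pow_le_pow_left₀ (abs_nonneg t) h 2
      rw [sq_abs] at this
      linarith
    calc _ ≤ M * Real.pi * (1 + 4 * R ^ 2) := by gcongr
      _ ≤ _ := by linarith
  · push Not at h
    have ht1 : 4 * R ^ 2 ≤ t ^ 2 := by
      have := pow_le_pow_left₀ (by positivity) h.le 2
      rw [sq_abs] at this
      linarith
    have ht2 : 1 ≤ t ^ 2 := by nlinarith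
    have h1 : ∫ x, f x * (y / ((t - x) ^ 2 + y ^ 2)) ≤ ∫ x, f x * (4 / t ^ 2) := by
      refine integral_mono hint ((hf.integrable_of_hasCompactSupport hc).mul_const _) fun x => ?_
      by_cases hx : f x = 0
      · simp [hx]
      refine mul_le_mul_of_nonneg_left ?_ (h0 x)
      have h3 : |t| / 2 ≤ |t - x| := by
        have := abs_sub_abs_le_abs_sub t x
        have := hR x hx
        linarith
      have h4 := pow_le_pow_left₀ (by positivity) h3 2
      rw [sq_abs, div_pow, sq_abs] at h4
      rw [div_le_div_iff₀ (by positivity) (by positivity)]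
      nlinarith [sq_nonneg y]
    rw [integral_mul_const] at h1
    have h5 : (∫ x, f x) * (4 / t ^ 2) * (1 + t ^ 2) ≤ 8 * ∫ x, f x := by
      have : 4 / t ^ 2 * (1 + t ^ 2) ≤ 8 := by
        rw [div_mul_eq_mul_div, div_le_iff₀ (by positivity)]
        linarith
      nlinarith
    have h6 : 0 ≤ M * Real.pi * (1 + 4 * R ^ 2) := by positivity
    nlinarith [mul_le_mul_of_nonneg_right h1 ht.le]

theorem measurable_poisson_ofReal (y : ℝ) :
    Measurable fun p : ℝ × ℝ => ENNReal.ofReal (y / ((p.1 - p.2) ^ 2 + y ^ 2)) := by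
  fun_prop

/-- Poisson integrals of a measure converge vaguely to the measure, up to the factor `π`. -/
theorem tendsto_lintegral_poisson (μ : Measure ℝ) [SFinite μ]
    (hμ : ∫⁻ t, ENNReal.ofReal ((1 + t ^ 2)⁻¹) ∂μ ≠ ⊤) {f : ℝ → ℝ} (hf : Continuous f)
    (hc : HasCompactSupport f) (h0 : ∀ x, 0 ≤ f x) {y : ℕ → ℝ} (hy : ∀ n, 0 < y n)
    (hy1 : ∀ n, y n ≤ 1) (hy0 : Tendsto y atTop (𝓝 0)) :
    Tendsto (fun n => ∫⁻ x, ENNReal.ofReal (f x) *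
        ∫⁻ t, ENNReal.ofReal (y n / ((t - x) ^ 2 + y n ^ 2)) ∂μ) atTop
      (𝓝 (∫⁻ t, ENNReal.ofReal (Real.pi * f t) ∂μ)) := by
  obtain ⟨M, hM⟩ := hc.exists_bound_of_continuous hf
  obtain ⟨C, hC⟩ := exists_bound_integral_mul_poisson hf hc h0
  have hmeas : ∀ n, Measurable fun p : ℝ × ℝ => ENNReal.ofReal (f p.2) *
      ENNReal.ofReal (y n / ((p.1 - p.2) ^ 2 + y n ^ 2)) := fun n =>
    ((hf.measurable.comp measurable_snd).ennreal_ofReal).mul (measurable_poisson_ofReal (y n))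
  -- Tonelli moves the Poisson kernel from the measure to the test function.
  have hswap : ∀ n, ∫⁻ x, ENNReal.ofReal (f x) *
        ∫⁻ t, ENNReal.ofReal (y n / ((t - x) ^ 2 + y n ^ 2)) ∂μ =
      ∫⁻ t, (∫⁻ x, ENNReal.ofReal (f x) *
        ENNReal.ofReal (y n / ((t - x) ^ 2 + y n ^ 2))) ∂μ := fun n => by
    rw [lintegral_lintegral_swap (hmeas n).aemeasurable]
    refine lintegral_congr fun x => ?_
    have hm : Measurable fun t => ENNReal.ofReal (y n / ((t - x) ^ 2 + y n ^ 2)) := by fun_prop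
    exact (lintegral_const_mul _ hm).symm
  have hval : ∀ n t, ∫⁻ x, ENNReal.ofReal (f x) *
        ENNReal.ofReal (y n / ((t - x) ^ 2 + y n ^ 2)) =
      ENNReal.ofReal (∫ x, f x * (y n / ((t - x) ^ 2 + y n ^ 2))) := fun n t => by
    have hint : Integrable fun x => f x * (y n / ((t - x) ^ 2 + y n ^ 2)) :=
      (hf.mul (continuous_poisson t (hy n))).integrable_of_hasCompactSupport hc.mul_right
    rw [ofReal_integral_eq_lintegral_ofReal hint
      (Eventually.of_forall fun x => mul_nonneg (h0 x) (div_nonneg (hy n).le (by positivity)))]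
    exact lintegral_congr fun x => (ENNReal.ofReal_mul (h0 x)).symm
  simp_rw [hswap]
  refine tendsto_lintegral_of_dominated_convergence
    (fun t => ENNReal.ofReal C * ENNReal.ofReal ((1 + t ^ 2)⁻¹)) (fun n => ?_)
    (fun n => Eventually.of_forall fun t => ?_) ?_ (Eventually.of_forall fun t => ?_)
  · exact (hmeas n).lintegral_prod_right'
  · simp only [hval]
    rw [← ENNReal.ofReal_mul' (by positivity)]
    exact ENNReal.ofReal_le_ofReal (hC t (y n) (hy n) (hy1 n))
  · rw [lintegral_const_mul _ (by fun_prop)]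
    exact ENNReal.mul_ne_top ENNReal.ofReal_ne_top hμ
  · simp only [hval]
    exact ENNReal.tendsto_ofReal (tendsto_integral_mul_poisson hf hM t hy hy0)

/-- A measure on the line is determined by its Poisson integrals, even when these are only known
up to a term which is linear in the imaginary part. -/
theorem measure_eq_of_poisson_eq (μ ν : Measure ℝ) [IsLocallyFiniteMeasure μ]
    [IsLocallyFiniteMeasure ν] {d e : ℝ}
    (hμ : ∫⁻ t, ENNReal.ofReal ((1 + t ^ 2)⁻¹) ∂μ ≠ ⊤)
    (hν : ∫⁻ t, ENNReal.ofReal ((1 + t ^ 2)⁻¹) ∂ν ≠ ⊤)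
    (h : ∀ x y : ℝ, 0 < y →
      ∫⁻ t, ENNReal.ofReal (y / ((t - x) ^ 2 + y ^ 2)) ∂μ + ENNReal.ofReal (y * d) =
      ∫⁻ t, ENNReal.ofReal (y / ((t - x) ^ 2 + y ^ 2)) ∂ν + ENNReal.ofReal (y * e)) :
    μ = ν := by
  have key : ∀ (ρ : Measure ℝ) [IsLocallyFiniteMeasure ρ] (c : ℝ),
      ∫⁻ t, ENNReal.ofReal ((1 + t ^ 2)⁻¹) ∂ρ ≠ ⊤ → ∀ f : ℝ → ℝ, Continuous f →
      HasCompactSupport f → (∀ x, 0 ≤ f x) →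
      Tendsto (fun n : ℕ => ∫⁻ x, ENNReal.ofReal (f x) *
        (∫⁻ t, ENNReal.ofReal ((1 / (n + 1 : ℝ)) / ((t - x) ^ 2 + (1 / (n + 1 : ℝ)) ^ 2)) ∂ρ +
          ENNReal.ofReal (1 / (n + 1 : ℝ) * c))) atTop
      (𝓝 (∫⁻ t, ENNReal.ofReal (Real.pi * f t) ∂ρ)) := by
    intro ρ _ c hρ f hf hc h0
    have h1 := tendsto_lintegral_poisson ρ hρ hf hc h0 (y := fun n : ℕ => 1 / (n + 1 : ℝ))
      (fun n => by positivity)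
      (fun n => by
        rw [div_le_one (by positivity)]
        linarith [(Nat.cast_nonneg n : (0 : ℝ) ≤ n)])
      tendsto_one_div_add_atTop_nhds_zero_nat
    -- The linear term contributes at most a multiple of `y` times the finite integral of `f`, so it
    -- disappears as `y → 0`.
    have h2 : Tendsto (fun n : ℕ => (∫⁻ x, ENNReal.ofReal (f x)) *
        ENNReal.ofReal (1 / (n + 1 : ℝ) * c)) atTop (𝓝 0) := by
      have h3 : Tendsto (fun n : ℕ => ENNReal.ofReal (1 / (n + 1 : ℝ) * c)) atTop (𝓝 0) := by
        have := ENNReal.tendsto_ofReal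
          ((tendsto_one_div_add_atTop_nhds_zero_nat (𝕜 := ℝ)).mul_const c)
        simpa using this
      have hfin : ∫⁻ x, ENNReal.ofReal (f x) ≠ ⊤ := by
        rw [← ofReal_integral_eq_lintegral_ofReal (hf.integrable_of_hasCompactSupport hc)
          (Eventually.of_forall h0)]
        exact ENNReal.ofReal_ne_top
      simpa using ENNReal.Tendsto.const_mul h3 (Or.inr hfin)
    have h4 := h1.add h2
    rw [add_zero] at h4
    refine h4.congr fun n => ?_
    rw [← lintegral_mul_const _ hf.measurable.ennreal_ofReal, ← lintegral_add_right _ (by fun_prop)]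
    exact lintegral_congr fun x => (mul_add _ _ _).symm
  refine Measure.ext_of_integral_eq_on_compactlySupported_nnreal fun g => ?_
  have hg : Continuous fun x => (g x : ℝ) := NNReal.continuous_coe.comp g.continuous
  have hgc : HasCompactSupport fun x => (g x : ℝ) :=
    g.hasCompactSupport.comp_left (g := fun r : NNReal => (r : ℝ)) rfl
  have hg0 : ∀ x, 0 ≤ (g x : ℝ) := fun x => (g x).2
  have h1 := key μ d hμ _ hg hgc hg0
  have h2 := key ν e hν _ hg hgc hg0
  have h3 := tendsto_nhds_unique h1
    (h2.congr fun n => lintegral_congr fun x => by rw [h x _ (by positivity)])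
  have h4 : ∀ (ρ : Measure ℝ) [IsLocallyFiniteMeasure ρ],
      ∫⁻ t, ENNReal.ofReal (Real.pi * g t) ∂ρ = ENNReal.ofReal (Real.pi * ∫ t, (g t : ℝ) ∂ρ) := by
    intro ρ _
    rw [← integral_const_mul, ofReal_integral_eq_lintegral_ofReal
      ((hg.integrable_of_hasCompactSupport hgc).const_mul _)
      (Eventually.of_forall fun x => mul_nonneg Real.pi_pos.le (hg0 x))]
  rw [h4 μ, h4 ν, ENNReal.ofReal_eq_ofReal_iff
    (mul_nonneg Real.pi_pos.le (integral_nonneg hg0))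
    (mul_nonneg Real.pi_pos.le (integral_nonneg hg0))] at h3
  exact mul_left_cancel₀ Real.pi_ne_zero h3

/-- The Poisson integral of Lebesgue measure. -/
theorem lintegral_poisson_volume (x : ℝ) {y : ℝ} (hy : 0 < y) :
    ∫⁻ t, ENNReal.ofReal (y / ((t - x) ^ 2 + y ^ 2)) = ENNReal.ofReal Real.pi := by
  have h1 := integral_mul_poisson_eq (fun _ => 1) x hy
  simp only [one_mul, integral_univ_inv_one_add_sq] at h1
  have h2 : ∀ t : ℝ, (t - x) ^ 2 = (x - t) ^ 2 := fun t => by ring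
  simp_rw [h2]
  rw [← h1, ofReal_integral_eq_lintegral_ofReal]
  -- A non-integrable kernel would have Bochner integral `0` by convention, whereas the value is
  -- `π`.
  · by_contra hn
    rw [integral_undef hn] at h1
    exact Real.pi_ne_zero h1.symm
  · exact Eventually.of_forall fun t => div_nonneg hy.le (by positivity)

end StieltjesInversion

/-! ### Scalar measures attached to an operator measure, and the scalar integral representation. -/

section ScalarMeasures

variable {H : Type*} [NormedAddCommGroup H] [InnerProductSpace ℂ H] [CompleteSpace H]
variable {G : Type*} [NormedAddCommGroup G] [InnerProductSpace ℂ G] [CompleteSpace G]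

/-- The bounded Borel sets `{t | n ≤ |t| < n + 1}`, which partition the line. -/
def absWindow (n : ℕ) : Set ℝ := {t | ⌊|t|⌋₊ = n}

theorem measurableSet_absWindow (n : ℕ) : MeasurableSet (absWindow n) := by
  have h : Measurable fun t : ℝ => ⌊|t|⌋₊ := Nat.measurable_floor.comp measurable_norm
  exact h (measurableSet_singleton n)

theorem isBounded_absWindow (n : ℕ) : Bornology.IsBounded (absWindow n) := by
  refine (Metric.isBounded_Icc (-(n + 1 : ℝ)) (n + 1)).subset fun t ht => abs_le.1 ?_
  have := (Nat.lt_floor_add_one |t|).le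
  rwa [show ⌊|t|⌋₊ = n from ht] at this

theorem pairwise_disjoint_absWindow : Pairwise (Function.onFun Disjoint absWindow) :=
  fun _ _ hij => Set.disjoint_left.2 fun _ hi hj => hij (hi.symm.trans hj)

theorem iUnion_absWindow : ⋃ n, absWindow n = univ :=
  eq_univ_of_forall fun t => mem_iUnion.2 ⟨⌊|t|⌋₊, rfl⟩

namespace OperatorMeasure

/-- The quadratic form of a value of an operator measure. -/
noncomputable def form (S : OperatorMeasure H) (h : H) (δ : Set ℝ) : ℝ :=
  (inner ℂ h (S.toFun δ h)).re

theorem form_nonneg (S : OperatorMeasure H) (h : H) {δ : Set ℝ} (hδ : MeasurableSet δ)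
    (hb : Bornology.IsBounded δ) : 0 ≤ S.form h δ :=
  (S.positive δ hδ hb).re_inner_nonneg_right h

theorem coe_form (S : OperatorMeasure H) (h : H) {δ : Set ℝ} (hδ : MeasurableSet δ)
    (hb : Bornology.IsBounded δ) : (S.form h δ : ℂ) = inner ℂ h (S.toFun δ h) := by
  have := (S.positive δ hδ hb).inner_nonneg_right h
  rw [Complex.le_def] at this
  exact Complex.ext rfl (by simpa using this.2)

theorem hasSum_form (S : OperatorMeasure H) (h : H) (δ : ℕ → Set ℝ)
    (hδ : ∀ i, MeasurableSet (δ i)) (hd : Pairwise (Function.onFun Disjoint δ))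
    (hb : Bornology.IsBounded (⋃ i, δ i)) :
    HasSum (fun i => S.form h (δ i)) (S.form h (⋃ i, δ i)) :=
  ((S.hasSum δ hδ hd hb h).mapL (innerSL ℂ h)).mapL Complex.reCLM

theorem isBounded_inter_absWindow (δ : Set ℝ) (n : ℕ) :
    Bornology.IsBounded (δ ∩ absWindow n) :=
  (isBounded_absWindow n).subset inter_subset_right

/-- The quadratic form of an operator measure on one window, as a measure. -/
noncomputable def windowMeasure (S : OperatorMeasure H) (h : H) (n : ℕ) : Measure ℝ :=
  Measure.ofMeasurable (fun δ _ => ENNReal.ofReal (S.form h (δ ∩ absWindow n)))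
    (by simp [form, S.map_empty])
    (by
      intro δ hδ hd
      have hb : Bornology.IsBounded (⋃ i, δ i ∩ absWindow n) := by
        rw [← iUnion_inter]
        exact isBounded_inter_absWindow _ n
      have hs := S.hasSum_form h (fun i => δ i ∩ absWindow n)
        (fun i => (hδ i).inter (measurableSet_absWindow n))
        (fun i j hij => (hd hij).mono inter_subset_left inter_subset_left) hb
      rw [← iUnion_inter] at hs
      rw [← hs.tsum_eq]
      exact ENNReal.ofReal_tsum_of_nonneg (fun i => S.form_nonneg h
        ((hδ i).inter (measurableSet_absWindow n)) (isBounded_inter_absWindow _ n)) hs.summable)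

/-- The Borel measure on the line whose value on a bounded set `δ` is the quadratic form of
`S(δ)`. -/
noncomputable def scalarMeasure (S : OperatorMeasure H) (h : H) : Measure ℝ :=
  Measure.sum (S.windowMeasure h)

/-- Countable additivity over the windows reassembles the value. The windows are needed because
`S.toFun` means nothing on unbounded sets. -/
theorem scalarMeasure_apply (S : OperatorMeasure H) (h : H) {δ : Set ℝ} (hδ : MeasurableSet δ)
    (hb : Bornology.IsBounded δ) : S.scalarMeasure h δ = ENNReal.ofReal (S.form h δ) := by
  have hU : ⋃ n, δ ∩ absWindow n = δ := by rw [← inter_iUnion, iUnion_absWindow, inter_univ]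
  have hs := S.hasSum_form h (fun n => δ ∩ absWindow n)
    (fun n => hδ.inter (measurableSet_absWindow n))
    (fun i j hij => (pairwise_disjoint_absWindow hij).mono inter_subset_right inter_subset_right)
    (by rwa [hU])
  rw [hU] at hs
  rw [scalarMeasure, Measure.sum_apply _ hδ, ← hs.tsum_eq,
    ENNReal.ofReal_tsum_of_nonneg (fun n => S.form_nonneg h
      (hδ.inter (measurableSet_absWindow n)) (isBounded_inter_absWindow _ n)) hs.summable]
  exact tsum_congr fun n => Measure.ofMeasurable_apply δ hδ

theorem scalarMeasure_real (S : OperatorMeasure H) (h : H) {δ : Set ℝ} (hδ : MeasurableSet δ)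
    (hb : Bornology.IsBounded δ) : (S.scalarMeasure h).real δ = S.form h δ := by
  rw [Measure.real, S.scalarMeasure_apply h hδ hb, ENNReal.toReal_ofReal (S.form_nonneg h hδ hb)]

instance isLocallyFiniteMeasure_scalarMeasure (S : OperatorMeasure H) (h : H) :
    IsLocallyFiniteMeasure (S.scalarMeasure h) :=
  ⟨fun x => ⟨Metric.closedBall x 1, Metric.closedBall_mem_nhds x one_pos, by
    rw [S.scalarMeasure_apply h Metric.isClosed_closedBall.measurableSet
      Metric.isBounded_closedBall]
    exact ENNReal.ofReal_lt_top⟩⟩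

theorem inner_simpleIntegral (S : OperatorMeasure H) (h : H) {β : Set ℝ} (hβ : MeasurableSet β)
    (hb : Bornology.IsBounded β) (s : SimpleFunc ℝ ℂ) :
    inner ℂ h (S.simpleIntegral β s h) = ∫ t in β, s t ∂S.scalarMeasure h := by
  have : IsFiniteMeasure ((S.scalarMeasure h).restrict β) := ⟨by
    rw [Measure.restrict_apply_univ, S.scalarMeasure_apply h hβ hb]
    exact ENNReal.ofReal_lt_top⟩
  rw [← SimpleFunc.integral_eq_integral s (SimpleFunc.integrable_of_isFiniteMeasure s),
    SimpleFunc.integral_eq, simpleIntegral]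
  simp only [sum_apply, inner_sum, smul_apply,
    inner_smul_right]
  refine Finset.sum_congr (by congr) fun c _ => ?_
  have hm := s.measurableSet_fiber c
  rw [measureReal_restrict_apply hm, S.scalarMeasure_real h (hm.inter hβ)
    (hb.subset inter_subset_right), Complex.real_smul,
    S.coe_form h (hm.inter hβ) (hb.subset inter_subset_right), mul_comm]

/-- Whatever approximating simple functions are chosen, they are eventually within `1` of `f`, so
`‖f‖ + 1` dominates and the limit of the forms is the scalar integral. -/
theorem HasIntegralOn.inner_eq {S : OperatorMeasure H} {a b : ℝ} {f : ℝ → ℂ}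
    (hf : Continuous f) {T : H →L[ℂ] H} (hT : S.HasIntegralOn (Ico a b) f T) (h : H) :
    inner ℂ h (T h) = ∫ t in Ico a b, f t ∂S.scalarMeasure h := by
  obtain ⟨s, hs, hlim⟩ := hT
  have hint : IntegrableOn f (Ico a b) (S.scalarMeasure h) :=
    (hf.continuousOn.integrableOn_compact isCompact_Icc).mono_set Ico_subset_Icc_self
  have hone : IntegrableOn (fun _ => (1 : ℝ)) (Ico a b) (S.scalarMeasure h) :=
    (continuous_const.continuousOn.integrableOn_compact isCompact_Icc).mono_set
      Ico_subset_Icc_self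
  have h1 : Tendsto (fun k => ∫ t in Ico a b, s k t ∂S.scalarMeasure h) atTop
      (𝓝 (∫ t in Ico a b, f t ∂S.scalarMeasure h)) := by
    refine tendsto_integral_filter_of_dominated_convergence (fun t => ‖f t‖ + 1)
      (Eventually.of_forall fun k => (s k).measurable.aestronglyMeasurable) ?_
      (hint.norm.add hone)
      (ae_restrict_of_forall_mem measurableSet_Ico fun t ht => hs.tendsto_at ht)
    filter_upwards [Metric.tendstoUniformlyOn_iff.1 hs 1 one_pos] with k hk
    refine ae_restrict_of_forall_mem measurableSet_Ico fun t ht => ?_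
    have h2 := (hk t ht).le
    rw [dist_comm, dist_eq_norm] at h2
    have h3 := norm_add_le (f t) (s k t - f t)
    rw [add_sub_cancel] at h3
    linarith
  refine tendsto_nhds_unique (((innerSL ℂ h).continuous.tendsto _).comp (hlim h)) ?_
  refine h1.congr fun k => ?_
  exact (S.inner_simpleIntegral h measurableSet_Ico (Metric.isBounded_Ico a b) (s k)).symm

theorem HasStrongIntegral.tendsto_setIntegral {S : OperatorMeasure H} {f : ℝ → ℂ}
    (hf : Continuous f) {T : H →L[ℂ] H} (hT : S.HasStrongIntegral f T) (h : H) :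
    Tendsto (fun p : ℝ × ℝ => ∫ t in Ico p.1 p.2, f t ∂S.scalarMeasure h) (atBot ×ˢ atTop)
      (𝓝 (inner ℂ h (T h))) := by
  obtain ⟨I, hI, hlim⟩ := hT
  exact (((innerSL ℂ h).continuous.tendsto _).comp (hlim h)).congr
    fun p => (hI p.1 p.2).inner_eq hf h

end OperatorMeasure

/-- For a nonnegative integrand the improper integral is the Lebesgue integral, with no
integrability assumed beforehand. -/
theorem lintegral_eq_of_tendsto_setIntegral (μ : Measure ℝ) [IsLocallyFiniteMeasure μ]
    {g : ℝ → ℝ} (hg : Continuous g) (h0 : ∀ t, 0 ≤ g t) {c : ℝ}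
    (h : Tendsto (fun p : ℝ × ℝ => ∫ t in Ico p.1 p.2, g t ∂μ) (atBot ×ˢ atTop) (𝓝 c)) :
    ∫⁻ t, ENNReal.ofReal (g t) ∂μ = ENNReal.ofReal c := by
  refine (aecover_Ico (μ := μ) (tendsto_fst : Tendsto _ (atBot ×ˢ atTop) atBot)
    (tendsto_snd : Tendsto _ ((atBot : Filter ℝ) ×ˢ atTop) atTop)).lintegral_eq_of_tendsto _
    hg.measurable.ennreal_ofReal.aemeasurable ?_
  refine (ENNReal.tendsto_ofReal h).congr fun p => ?_
  exact ofReal_integral_eq_lintegral_ofReal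
    ((hg.continuousOn.integrableOn_compact isCompact_Icc).mono_set Ico_subset_Icc_self)
    (Eventually.of_forall h0)

theorem continuous_nevanlinnaKernel {z : ℂ} (hz : z.im ≠ 0) :
    Continuous fun t : ℝ => 1 / ((t : ℂ) - z) - (t : ℂ) / (1 + (t : ℂ) ^ 2) := by
  refine .sub (.div (by fun_prop) (by fun_prop) fun t h => ?_)
    (.div (by fun_prop) (by fun_prop) fun t h => ?_)
  · exact hz (by simpa using congrArg Complex.im h)
  · have h1 : ((1 + t ^ 2 : ℝ) : ℂ) = 0 := by push_cast; exact h
    have h2 : (1 + t ^ 2 : ℝ) = 0 := by exact_mod_cast h1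
    nlinarith [sq_nonneg t]

theorem nevanlinnaKernel_im (z : ℂ) (t : ℝ) :
    (1 / ((t : ℂ) - z) - (t : ℂ) / (1 + (t : ℂ) ^ 2)).im =
      z.im / ((t - z.re) ^ 2 + z.im ^ 2) := by
  have h1 : ((t : ℂ) / (1 + (t : ℂ) ^ 2)) = ((t / (1 + t ^ 2) : ℝ) : ℂ) := by push_cast; rfl
  rw [h1, Complex.sub_im, Complex.ofReal_im, sub_zero, one_div, Complex.inv_im,
    Complex.normSq_apply]
  simp [pow_two]

namespace IsSpectralData

variable {F : ℂ → H →L[ℂ] H} {C D : H →L[ℂ] H} {S : OperatorMeasure H}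

theorem inner_selfAdjoint_im (hS : IsSpectralData F C D S) (h : H) :
    (inner ℂ h (C h)).im = 0 :=
  hS.selfAdjoint.isSymmetric.im_inner_self_apply h

/-- Take imaginary parts in the representation: `C` and the real term `t/(1+t²)` drop out, `D`
contributes `y ⟨h, D h⟩`, and the Poisson kernel remains. The sign statement is included because
`ENNReal.ofReal` would otherwise truncate. -/
theorem lintegral_poisson (hS : IsSpectralData F C D S) (h : H) (x : ℝ) {y : ℝ} (hy : 0 < y) :
    0 ≤ (inner ℂ h (F ⟨x, y⟩ h)).im ∧
    ∫⁻ t, ENNReal.ofReal (y / ((t - x) ^ 2 + y ^ 2)) ∂S.scalarMeasure h +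
        ENNReal.ofReal (y * (inner ℂ h (D h)).re) =
      ENNReal.ofReal (inner ℂ h (F ⟨x, y⟩ h)).im := by
  have hz : (⟨x, y⟩ : ℂ).im ≠ 0 := hy.ne'
  have hcont := continuous_nevanlinnaKernel hz
  have h1 := (hS.representation ⟨x, y⟩ hz).tendsto_setIntegral hcont h
  have h2 := (Complex.continuous_im.tendsto _).comp h1
  have hD := hS.positive.inner_nonneg_right h
  rw [Complex.le_def] at hD
  have h3 : (inner ℂ h ((F ⟨x, y⟩ - C - (⟨x, y⟩ : ℂ) • D) h)).im =
      (inner ℂ h (F ⟨x, y⟩ h)).im - y * (inner ℂ h (D h)).re := by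
    simp only [sub_apply, smul_apply, inner_sub_right,
      inner_smul_right, Complex.sub_im, Complex.mul_im, hS.inner_selfAdjoint_im h]
    rw [← hD.2]
    simp
  rw [h3] at h2
  have h4 : Tendsto (fun p : ℝ × ℝ => ∫ t in Ico p.1 p.2, y / ((t - x) ^ 2 + y ^ 2)
      ∂S.scalarMeasure h) (atBot ×ˢ atTop)
      (𝓝 ((inner ℂ h (F ⟨x, y⟩ h)).im - y * (inner ℂ h (D h)).re)) := by
    refine h2.congr fun p => ?_
    have hint : IntegrableOn _ (Ico p.1 p.2) (S.scalarMeasure h) :=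
      (hcont.continuousOn.integrableOn_compact isCompact_Icc).mono_set Ico_subset_Icc_self
    refine (Complex.imCLM.integral_comp_comm hint).symm.trans ?_
    exact integral_congr_ae (Eventually.of_forall fun t => nevanlinnaKernel_im ⟨x, y⟩ t)
  have h0 : ∀ t : ℝ, 0 ≤ y / ((t - x) ^ 2 + y ^ 2) := fun t =>
    div_nonneg hy.le (by positivity)
  have hc : Continuous fun t : ℝ => y / ((t - x) ^ 2 + y ^ 2) :=
    .div (by fun_prop) (by fun_prop) fun t => by positivity
  have h5 := ge_of_tendsto' h4 fun p => integral_nonneg h0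
  have h6 := mul_nonneg hy.le hD.1
  refine ⟨h6.trans (sub_nonneg.1 h5), ?_⟩
  rw [lintegral_eq_of_tendsto_setIntegral _ hc h0 h4, ← ENNReal.ofReal_add h5 h6, sub_add_cancel]

/-- The weight is the Poisson kernel at `z = i`. -/
theorem lintegral_weight_ne_top (hS : IsSpectralData F C D S) (h : H) :
    ∫⁻ t, ENNReal.ofReal ((1 + t ^ 2)⁻¹) ∂S.scalarMeasure h ≠ ⊤ := by
  have h1 := (hS.lintegral_poisson h 0 one_pos).2
  have h2 : ∀ t : ℝ, (1 + t ^ 2)⁻¹ = 1 / ((t - 0) ^ 2 + 1 ^ 2) := fun t => by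
    rw [one_div, sub_zero, one_pow, add_comm]
  simp_rw [h2]
  exact ne_top_of_le_ne_top ENNReal.ofReal_ne_top (le_self_add.trans h1.le)

end IsSpectralData
end ScalarMeasures

/-! ### Comparison of scalar spectral measures. -/

section Uniqueness

variable {H : Type*} [NormedAddCommGroup H] [InnerProductSpace ℂ H] [CompleteSpace H]
variable {G : Type*} [NormedAddCommGroup G] [InnerProductSpace ℂ G] [CompleteSpace G]

/-- If the imaginary parts of the quadratic forms of two Nevanlinna functions differ by a constant,
then the scalar spectral measures differ by a multiple of Lebesgue measure. -/
theorem scalarMeasure_add_volume_eq {F₁ : ℂ → H →L[ℂ] H} {C₁ D₁ : H →L[ℂ] H}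
    {S₁ : OperatorMeasure H} {F₂ : ℂ → G →L[ℂ] G} {C₂ D₂ : G →L[ℂ] G} {S₂ : OperatorMeasure G}
    (hS₁ : IsSpectralData F₁ C₁ D₁ S₁) (hS₂ : IsSpectralData F₂ C₂ D₂ S₂) (g : H) (h : G) (a b : NNReal)
    (hF : ∀ z : ℂ, 0 < z.im → (inner ℂ g (F₁ z g)).im + Real.pi * a =
      (inner ℂ h (F₂ z h)).im + Real.pi * b) :
    S₁.scalarMeasure g + a • volume = S₂.scalarMeasure h + b • volume := by
  have hvol : ∫⁻ t : ℝ, ENNReal.ofReal ((1 + t ^ 2)⁻¹) ≠ ⊤ := by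
    rw [← ofReal_integral_eq_lintegral_ofReal integrable_inv_one_add_sq
      (Eventually.of_forall fun t => by positivity)]
    exact ENNReal.ofReal_ne_top
  have hfin : ∀ (μ : Measure ℝ) (c : NNReal), ∫⁻ t, ENNReal.ofReal ((1 + t ^ 2)⁻¹) ∂μ ≠ ⊤ →
      ∫⁻ t, ENNReal.ofReal ((1 + t ^ 2)⁻¹) ∂(μ + c • volume) ≠ ⊤ := fun μ c hμ => by
    rw [lintegral_add_measure, lintegral_smul_measure]
    exact ENNReal.add_ne_top.2 ⟨hμ, ENNReal.mul_ne_top ENNReal.coe_ne_top hvol⟩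
  -- Adding `c` times Lebesgue measure raises every Poisson integral by the constant `π c`.
  have hpoisson : ∀ (μ : Measure ℝ) (c : NNReal) (x y : ℝ), 0 < y →
      ∫⁻ t, ENNReal.ofReal (y / ((t - x) ^ 2 + y ^ 2)) ∂(μ + c • volume) =
      ∫⁻ t, ENNReal.ofReal (y / ((t - x) ^ 2 + y ^ 2)) ∂μ + ENNReal.ofReal (Real.pi * c) :=
    fun μ c x y hy => by
      rw [lintegral_add_measure, lintegral_smul_measure, lintegral_poisson_volume x hy,
        mul_comm Real.pi, ENNReal.ofReal_mul c.coe_nonneg, ENNReal.ofReal_coe_nnreal]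
      rfl
  have hlf : ∀ (μ : Measure ℝ) [IsLocallyFiniteMeasure μ] (c : NNReal),
      IsLocallyFiniteMeasure (μ + c • volume) := fun μ _ c =>
    ⟨fun x => ⟨Metric.closedBall x 1, Metric.closedBall_mem_nhds x one_pos, by
      rw [Measure.add_apply, Measure.smul_apply]
      exact ENNReal.add_lt_top.2 ⟨(isCompact_closedBall x 1).measure_lt_top,
        ENNReal.mul_lt_top ENNReal.coe_lt_top (isCompact_closedBall x 1).measure_lt_top⟩⟩⟩
  refine measure_eq_of_poisson_eq _ _ (hfin _ a (hS₁.lintegral_weight_ne_top g))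
    (hfin _ b (hS₂.lintegral_weight_ne_top h)) (d := (inner ℂ g (D₁ g)).re)
    (e := (inner ℂ h (D₂ h)).re) fun x y hy => ?_
  obtain ⟨h1, h2⟩ := hS₁.lintegral_poisson g x hy
  obtain ⟨h3, h4⟩ := hS₂.lintegral_poisson h x hy
  rw [hpoisson _ a x y hy, hpoisson _ b x y hy, add_right_comm, h2, add_right_comm, h4,
    ← ENNReal.ofReal_add h1 (by positivity), ← ENNReal.ofReal_add h3 (by positivity),
    hF ⟨x, y⟩ hy]

theorem form_sub_form_eq {F₁ : ℂ → H →L[ℂ] H} {C₁ D₁ : H →L[ℂ] H}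
    {S₁ : OperatorMeasure H} {F₂ : ℂ → G →L[ℂ] G} {C₂ D₂ : G →L[ℂ] G} {S₂ : OperatorMeasure G}
    (hS₁ : IsSpectralData F₁ C₁ D₁ S₁) (hS₂ : IsSpectralData F₂ C₂ D₂ S₂) (g : H) (h : G) (e : ℝ)
    (hF : ∀ z : ℂ, 0 < z.im → (inner ℂ g (F₁ z g)).im = (inner ℂ h (F₂ z h)).im + e)
    {δ : Set ℝ} (hδ : MeasurableSet δ) (hb : Bornology.IsBounded δ) :
    S₁.form g δ - S₂.form h δ = e / Real.pi * volume.real δ := by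
  have he : ((e / Real.pi).toNNReal : ℝ) - ((-(e / Real.pi)).toNNReal : ℝ) = e / Real.pi := by
    rw [Real.coe_toNNReal', Real.coe_toNNReal', max_zero_sub_eq_self]
  have h1 := scalarMeasure_add_volume_eq hS₁ hS₂ g h (-(e / Real.pi)).toNNReal
    (e / Real.pi).toNNReal fun z hz => by
      rw [hF z hz]
      have : Real.pi * (e / Real.pi) = e := mul_div_cancel₀ _ Real.pi_ne_zero
      linear_combination (-Real.pi) * he - this
  have hv : volume δ ≠ ⊤ := hb.measure_lt_top.ne
  have h2 := congrArg (fun μ : Measure ℝ => (μ δ).toReal) h1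
  simp only [Measure.add_apply, Measure.smul_apply, S₁.scalarMeasure_apply g hδ hb,
    S₂.scalarMeasure_apply h hδ hb, ENNReal.smul_def, smul_eq_mul] at h2
  rw [ENNReal.toReal_add ENNReal.ofReal_ne_top (ENNReal.mul_ne_top ENNReal.coe_ne_top hv),
    ENNReal.toReal_add ENNReal.ofReal_ne_top (ENNReal.mul_ne_top ENNReal.coe_ne_top hv),
    ENNReal.toReal_ofReal (S₁.form_nonneg g hδ hb),
    ENNReal.toReal_ofReal (S₂.form_nonneg h hδ hb)] at h2
  simp only [ENNReal.toReal_mul, ENNReal.coe_toReal] at h2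
  rw [Measure.real]
  linear_combination h2 + (volume δ).toReal * he

/-- Both sides are limits of the same truncated integrals. -/
theorem IsSpectralData.inner_sub_eq_of_scalarMeasure_eq {F₁ : ℂ → H →L[ℂ] H} {C₁ D₁ : H →L[ℂ] H}
    {S₁ : OperatorMeasure H} {F₂ : ℂ → G →L[ℂ] G} {C₂ D₂ : G →L[ℂ] G} {S₂ : OperatorMeasure G}
    (hS₁ : IsSpectralData F₁ C₁ D₁ S₁) (hS₂ : IsSpectralData F₂ C₂ D₂ S₂) {g : H} {h : G}
    (hμ : S₁.scalarMeasure g = S₂.scalarMeasure h) {z : ℂ} (hz : z.im ≠ 0) :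
    inner ℂ g ((F₁ z - C₁ - z • D₁) g) = inner ℂ h ((F₂ z - C₂ - z • D₂) h) := by
  have h1 := (hS₁.representation z hz).tendsto_setIntegral (continuous_nevanlinnaKernel hz) g
  rw [hμ] at h1
  exact tendsto_nhds_unique h1
    ((hS₂.representation z hz).tendsto_setIntegral (continuous_nevanlinnaKernel hz) h)

end Uniqueness

theorem ext_inner_self_right {H : Type*} [NormedAddCommGroup H]
    [InnerProductSpace ℂ H] {A B : H →L[ℂ] H} (h : ∀ x, inner ℂ x (A x) = inner ℂ x (B x)) :
    A = B := by
  rw [← sub_eq_zero]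
  have h1 : ∀ x, inner ℂ ((A - B : H →L[ℂ] H) x) x = 0 := fun x => by
    rw [← inner_conj_symm, sub_apply, inner_sub_right, h x, sub_self, map_zero]
  ext x
  exact congrArg (fun f => f x) ((inner_map_self_eq_zero ((A - B : H →L[ℂ] H) : H →ₗ[ℂ] H)).1 h1)

/-! ### Congruence by `K⁻¹` and inversion of the transform. -/

section PullBack

variable {H : Type*} [NormedAddCommGroup H] [InnerProductSpace ℂ H] [CompleteSpace H]
variable {G : Type*} [NormedAddCommGroup G] [InnerProductSpace ℂ G] [CompleteSpace G]

/-- The vector `(K⁻¹)* h`. -/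
noncomputable def dualVector (K : G ≃L[ℂ] H) (h : G) : H :=
  ContinuousLinearMap.adjoint (K.symm : H →L[ℂ] G) h

/-- This lets the scalar results be applied to the original `F_j` at the vector `(K⁻¹)* h`, so the
pulled-back functions need no integral representation of their own. -/
theorem inner_pullBack (K : G ≃L[ℂ] H) (T : H →L[ℂ] H) (h : G) :
    inner ℂ h (pullBack K T h) = inner ℂ (dualVector K h) (T (dualVector K h)) := by
  rw [dualVector, ContinuousLinearMap.adjoint_inner_left]
  rfl

theorem form_pullBack (K : G ≃L[ℂ] H) (S : OperatorMeasure H) (h : G) (δ : Set ℝ) :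
    (S.pullBack K).form h δ = S.form (dualVector K h) δ :=
  congrArg Complex.re (inner_pullBack K (S.toFun δ) h)

theorem pullBack_sub (K : G ≃L[ℂ] H) (T U : H →L[ℂ] H) :
    pullBack K (T - U) = pullBack K T - pullBack K U := by
  ext x
  simp [pullBack]

theorem pullBack_smul (K : G ≃L[ℂ] H) (z : ℂ) (T : H →L[ℂ] H) :
    pullBack K (z • T) = z • pullBack K T := by
  ext x
  simp [pullBack]

theorem adjoint_pullBack (K : G ≃L[ℂ] H) (T : H →L[ℂ] H) :
    ContinuousLinearMap.adjoint (pullBack K T) = pullBack K (ContinuousLinearMap.adjoint T) := by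
  simp only [pullBack, ContinuousLinearMap.adjoint_comp, ContinuousLinearMap.adjoint_adjoint,
    ContinuousLinearMap.comp_assoc]

theorem differentiableOn_pullBack (K : G ≃L[ℂ] H) {F : ℂ → H →L[ℂ] H} {P : Set ℂ}
    (hF : DifferentiableOn ℂ F P) : DifferentiableOn ℂ (fun z => pullBack K (F z)) P :=
  (differentiableOn_const _).clm_comp (hF.clm_comp (differentiableOn_const _))

theorem adjoint_symm_comp_adjoint (K : G ≃L[ℂ] H) :
    ContinuousLinearMap.adjoint (K.symm : H →L[ℂ] G) ∘L
      ContinuousLinearMap.adjoint (K : G →L[ℂ] H) = 1 := by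
  rw [← ContinuousLinearMap.adjoint_comp, ContinuousLinearEquiv.coe_comp_coe_symm]
  exact star_one (H →L[ℂ] H)

theorem adjoint_comp_adjoint_symm (K : G ≃L[ℂ] H) :
    ContinuousLinearMap.adjoint (K : G →L[ℂ] H) ∘L
      ContinuousLinearMap.adjoint (K.symm : H →L[ℂ] G) = 1 := by
  rw [← ContinuousLinearMap.adjoint_comp, ContinuousLinearEquiv.coe_symm_comp_coe]
  exact star_one (G →L[ℂ] G)

theorem pullBack_mul_weylTransform {F : ℂ → H →L[ℂ] H} {B : H →L[ℂ] H} (K : G ≃L[ℂ] H) {z : ℂ}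
    (hu : IsUnit (B - F z)) : pullBack K (B - F z) * weylTransform F B K z = 1 := by
  have h1 := fun v => congrArg (fun f => f v) (adjoint_symm_comp_adjoint K)
  rw [weylTransform]
  generalize B - F z = A at hu
  have h2 := fun v => congrArg (fun f => f v) (Ring.mul_inverse_cancel _ hu)
  simp only [ContinuousLinearMap.comp_apply, mul_apply_eq_comp, one_apply_eq_self] at h1 h2
  ext x
  simp [pullBack, h1, h2]

theorem weylTransform_mul_pullBack {F : ℂ → H →L[ℂ] H} {B : H →L[ℂ] H} (K : G ≃L[ℂ] H) {z : ℂ}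
    (hu : IsUnit (B - F z)) : weylTransform F B K z * pullBack K (B - F z) = 1 := by
  have h1 := fun v => congrArg (fun f => f v) (adjoint_comp_adjoint_symm K)
  rw [weylTransform]
  generalize B - F z = A at hu
  have h2 := fun v => congrArg (fun f => f v) (Ring.inverse_mul_cancel _ hu)
  simp only [ContinuousLinearMap.comp_apply, mul_apply_eq_comp, one_apply_eq_self] at h1 h2
  ext x
  simp [pullBack, h1, h2]

end PullBack

/-! ### The constant difference, and tools for the three conditions. -/

section Comparison

variable {H H₁ H₂ : Type*}
  [NormedAddCommGroup H] [InnerProductSpace ℂ H] [CompleteSpace H]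
  [NormedAddCommGroup H₁] [InnerProductSpace ℂ H₁] [CompleteSpace H₁]
  [NormedAddCommGroup H₂] [InnerProductSpace ℂ H₂] [CompleteSpace H₂]

/-- The common value of the two transforms has one pulled-back `B - F` as left inverse and the other
as right inverse, so these coincide. -/
theorem pullBack_sub_eq_of_weylTransform_eq {F₁ : ℂ → H₁ →L[ℂ] H₁} {F₂ : ℂ → H₂ →L[ℂ] H₂}
    {B₁ : H₁ →L[ℂ] H₁} {B₂ : H₂ →L[ℂ] H₂} {K₁ : H ≃L[ℂ] H₁} {K₂ : H ≃L[ℂ] H₂} {z : ℂ}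
    (h₁ : IsUnit (B₁ - F₁ z)) (h₂ : IsUnit (B₂ - F₂ z))
    (h : weylTransform F₁ B₁ K₁ z = weylTransform F₂ B₂ K₂ z) :
    pullBack K₁ (F₁ z) - pullBack K₂ (F₂ z) = pullBack K₁ B₁ - pullBack K₂ B₂ := by
  have h3 := left_inv_eq_right_inv (pullBack_mul_weylTransform K₁ h₁)
    (h ▸ weylTransform_mul_pullBack K₂ h₂)
  rw [pullBack_sub, pullBack_sub] at h3
  rw [sub_eq_sub_iff_sub_eq_sub, ← neg_inj, neg_sub, neg_sub, h3]

/-- The identity theorem: the pulled back Nevanlinna functions differ by a constant on a connected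
domain which contains a common resolvent point. -/
theorem pullBack_sub_eq_on {F₁ : ℂ → H₁ →L[ℂ] H₁} {F₂ : ℂ → H₂ →L[ℂ] H₂}
    {B₁ : H₁ →L[ℂ] H₁} {B₂ : H₂ →L[ℂ] H₂} {K₁ : H ≃L[ℂ] H₁} {K₂ : H ≃L[ℂ] H₂} {P : Set ℂ}
    (hP : IsOpen P) (hPc : IsPreconnected P)
    (hF₁ : DifferentiableOn ℂ F₁ P) (hF₂ : DifferentiableOn ℂ F₂ P)
    (hΩ : (commonResolventPoints P F₁ B₁ F₂ B₂).Nonempty)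
    (hEq : ∀ z ∈ commonResolventPoints P F₁ B₁ F₂ B₂,
      weylTransform F₁ B₁ K₁ z = weylTransform F₂ B₂ K₂ z) {z : ℂ} (hz : z ∈ P) :
    pullBack K₁ (F₁ z) - pullBack K₂ (F₂ z) = pullBack K₁ B₁ - pullBack K₂ B₂ := by
  obtain ⟨w, hwP, hw₁, hw₂⟩ := hΩ
  have hPw : P ∈ 𝓝 w := hP.mem_nhds hwP
  have hd : DifferentiableOn ℂ (fun z => pullBack K₁ (F₁ z) - pullBack K₂ (F₂ z)) P :=
    (differentiableOn_pullBack K₁ hF₁).sub (differentiableOn_pullBack K₂ hF₂)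
  refine (hd.analyticOnNhd hP).eqOn_of_preconnected_of_eventuallyEq analyticOnNhd_const hPc hwP ?_
    hz
  -- Invertibility is an open condition, so the equality of transforms is available near `w`. The
  -- resolvent set need not be connected: the identity theorem is applied on `P`, where both
  -- functions are holomorphic.
  have hu₁ : ∀ᶠ z in 𝓝 w, IsUnit (B₁ - F₁ z) :=
    ((continuousAt_const.sub (hF₁.continuousOn.continuousAt hPw)).eventually
      (Units.isOpen.mem_nhds hw₁))
  have hu₂ : ∀ᶠ z in 𝓝 w, IsUnit (B₂ - F₂ z) :=
    ((continuousAt_const.sub (hF₂.continuousOn.continuousAt hPw)).eventually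
      (Units.isOpen.mem_nhds hw₂))
  filter_upwards [hu₁, hu₂, hPw] with v hv₁ hv₂ hvP
  exact pullBack_sub_eq_of_weylTransform_eq hv₁ hv₂ (hEq v ⟨hvP, hv₁, hv₂⟩)

theorem isOpen_upperHalf : IsOpen upperHalf := isOpen_lt continuous_const Complex.continuous_im

theorem isOpen_lowerHalf : IsOpen lowerHalf := isOpen_lt Complex.continuous_im continuous_const

theorem isPreconnected_upperHalf : IsPreconnected upperHalf :=
  (convex_halfSpace_im_gt 0).isPreconnected

theorem isPreconnected_lowerHalf : IsPreconnected lowerHalf :=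
  (convex_halfSpace_im_lt 0).isPreconnected

/-- A measure whose absolutely continuous part is not equivalent to Lebesgue measure vanishes on a
bounded set of positive Lebesgue measure. -/
theorem OperatorMeasure.exists_eq_zero_of_not_equivLebesgue [TopologicalSpace.SeparableSpace H]
    (S : OperatorMeasure H) (h : ¬ S.acPart.EquivLebesgue) :
    ∃ δ : Set ℝ, MeasurableSet δ ∧ Bornology.IsBounded δ ∧ volume δ ≠ 0 ∧ S.toFun δ = 0 := by
  unfold OperatorMeasure.EquivLebesgue at h
  push Not at h
  obtain ⟨δ, hδ, hb, h1⟩ := h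
  have h2 := S.absCont_acPart δ hδ hb
  -- Absolute continuity excludes one way for the equivalence to fail, leaving a set of positive
  -- measure that is null for the absolutely continuous part. Deleting the singular null set makes
  -- it null for `S` itself.
  have h3 : S.toFun (δ ∩ S.singularSetᶜ) = 0 ∧ volume δ ≠ 0 := by tauto
  refine ⟨δ ∩ S.singularSetᶜ, hδ.inter S.measurableSet_singularSet.compl,
    hb.subset inter_subset_left, ?_, h3.1⟩
  have hN : volume S.singularSet = 0 := S.exists_null_set.choose_spec.2.1
  rw [← sdiff_eq, measure_sdiff_null hN]
  exact h3.2

/-- If the distribution functions differ by a linear function in the quadratic form sense and have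
the same weak derivative at one point, then the linear function vanishes. -/
theorem eq_zero_of_hasWeakDerivAt {S T : OperatorMeasure H} {h : H} {c : ℝ}
    (hST : ∀ δ : Set ℝ, MeasurableSet δ → Bornology.IsBounded δ →
      S.form h δ - T.form h δ = c * volume.real δ) {A : H →L[ℂ] H} {t₀ : ℝ}
    (hS : HasWeakDerivAt S.distribution A t₀) (hT : HasWeakDerivAt T.distribution A t₀) :
    c = 0 := by
  -- Both distribution functions vanish at `0`, so no additive constant appears, for either sign of
  -- `t`.
  have h1 : ∀ t, inner ℂ h (S.distribution t h) - inner ℂ h (T.distribution t h) =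
      (c : ℂ) * (t : ℂ) := by
    have hI : ∀ a b : ℝ, a ≤ b → inner ℂ h (S.toFun (Ico a b) h) -
        inner ℂ h (T.toFun (Ico a b) h) = (c : ℂ) * ((b - a : ℝ) : ℂ) := fun a b hab => by
      have hb := Metric.isBounded_Ico a b
      have h2 := hST _ measurableSet_Ico hb
      rw [Real.volume_real_Ico_of_le hab] at h2
      rw [← S.coe_form h measurableSet_Ico hb, ← T.coe_form h measurableSet_Ico hb]
      exact_mod_cast h2
    intro t
    simp only [OperatorMeasure.distribution]
    rcases lt_trichotomy t 0 with ht | rfl | ht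
    · have := hI t 0 ht.le
      simp only [ht.not_gt, ht, if_true, if_false, neg_apply, inner_neg_right]
      push_cast at this
      linear_combination -this
    · simp
    · have := hI 0 t ht.le
      simp only [ht, if_true]
      push_cast at this
      linear_combination this
  have h2 := (hS h h).sub (hT h h)
  rw [sub_self] at h2
  have h3 : HasDerivAt (fun t : ℝ => (c : ℂ) * (t : ℂ)) ((c : ℂ) * 1) t₀ :=
    Complex.ofRealCLM.hasDerivAt.const_mul (c : ℂ)
  have h4 := h3.unique (h2.congr_of_eventuallyEq (Eventually.of_forall fun t => (h1 t).symm))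
  simpa using h4

end Comparison

/-! ### From the constant difference to the spectral data. -/

section Conclusion

variable {H H₁ H₂ : Type*}
  [NormedAddCommGroup H] [InnerProductSpace ℂ H] [CompleteSpace H]
  [NormedAddCommGroup H₁] [InnerProductSpace ℂ H₁] [CompleteSpace H₁]
  [NormedAddCommGroup H₂] [InnerProductSpace ℂ H₂] [CompleteSpace H₂]

theorem form_pullBack_sub_form_pullBack {F₁ : ℂ → H₁ →L[ℂ] H₁} {C₁ D₁ : H₁ →L[ℂ] H₁}
    {S₁ : OperatorMeasure H₁} {F₂ : ℂ → H₂ →L[ℂ] H₂} {C₂ D₂ : H₂ →L[ℂ] H₂}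
    {S₂ : OperatorMeasure H₂} (hS₁ : IsSpectralData F₁ C₁ D₁ S₁)
    (hS₂ : IsSpectralData F₂ C₂ D₂ S₂) {K₁ : H ≃L[ℂ] H₁} {K₂ : H ≃L[ℂ] H₂} {E : H →L[ℂ] H}
    (hE : ∀ z ∈ upperHalf, pullBack K₁ (F₁ z) - pullBack K₂ (F₂ z) = E) (h : H) {δ : Set ℝ}
    (hδ : MeasurableSet δ) (hb : Bornology.IsBounded δ) :
    (S₁.pullBack K₁).form h δ - (S₂.pullBack K₂).form h δ =
      (inner ℂ h (E h)).im / Real.pi * volume.real δ := by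
  rw [form_pullBack, form_pullBack]
  refine form_sub_form_eq hS₁ hS₂ _ _ _ (fun z hz => ?_) hδ hb
  rw [← hE z hz, sub_apply, inner_sub_right, inner_pullBack, inner_pullBack, Complex.sub_im]
  ring

/-- On the null set of `T` the nonnegative form of `S` equals `c` times a positive number. -/
theorem nonneg_of_form_sub_form_eq {S : OperatorMeasure H₁} {T : OperatorMeasure H₂} {g : H₁}
    {h : H₂} {c : ℝ} (hST : ∀ δ : Set ℝ, MeasurableSet δ → Bornology.IsBounded δ →
      S.form g δ - T.form h δ = c * volume.real δ) {δ : Set ℝ} (hδ : MeasurableSet δ)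
    (hb : Bornology.IsBounded δ) (hv : volume δ ≠ 0) (hT : T.toFun δ = 0) : 0 ≤ c := by
  have h1 := hST δ hδ hb
  have h2 := S.form_nonneg g hδ hb
  have h3 : T.form h δ = 0 := by simp [OperatorMeasure.form, hT]
  have h4 : 0 < volume.real δ := ENNReal.toReal_pos hv hb.measure_lt_top.ne
  rw [h3, sub_zero] at h1
  exact nonneg_of_mul_nonneg_left (h1 ▸ h2) h4

/-- If the pulled back Nevanlinna functions differ in the upper half-plane by a constant with
vanishing imaginary part, then their spectral measures and linear coefficients agree and the
constant is the difference of the constant coefficients. -/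
theorem pullBack_spectralData_eq {F₁ : ℂ → H₁ →L[ℂ] H₁} {C₁ D₁ : H₁ →L[ℂ] H₁}
    {S₁ : OperatorMeasure H₁} {F₂ : ℂ → H₂ →L[ℂ] H₂} {C₂ D₂ : H₂ →L[ℂ] H₂}
    {S₂ : OperatorMeasure H₂} (hS₁ : IsSpectralData F₁ C₁ D₁ S₁)
    (hS₂ : IsSpectralData F₂ C₂ D₂ S₂) {K₁ : H ≃L[ℂ] H₁} {K₂ : H ≃L[ℂ] H₂} {E : H →L[ℂ] H}
    (hE : ∀ z ∈ upperHalf, pullBack K₁ (F₁ z) - pullBack K₂ (F₂ z) = E)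
    (hE0 : ∀ h, (inner ℂ h (E h)).im = 0) :
    (S₁.pullBack K₁).Same (S₂.pullBack K₂) ∧ pullBack K₁ D₁ = pullBack K₂ D₂ ∧
      pullBack K₁ C₁ - pullBack K₂ C₂ = E := by
  have hμ : ∀ h, S₁.scalarMeasure (dualVector K₁ h) = S₂.scalarMeasure (dualVector K₂ h) := by
    intro h
    have h1 := scalarMeasure_add_volume_eq hS₁ hS₂ (dualVector K₁ h) (dualVector K₂ h) 0 0
      fun z hz => by
        have h2 := hE0 h
        rw [← hE z hz, sub_apply, inner_sub_right, inner_pullBack, inner_pullBack,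
          Complex.sub_im] at h2
        linarith
    simpa using h1
  -- With equal scalar measures the integral terms cancel, and only the affine parts of the
  -- representations survive.
  have hlin : ∀ z ∈ upperHalf, E = (pullBack K₁ C₁ - pullBack K₂ C₂) +
      z • (pullBack K₁ D₁ - pullBack K₂ D₂) := by
    intro z hz
    have h1 : pullBack K₁ (F₁ z - C₁ - z • D₁) = pullBack K₂ (F₂ z - C₂ - z • D₂) :=
      ext_inner_self_right fun h => by
        rw [inner_pullBack, inner_pullBack]
        exact hS₁.inner_sub_eq_of_scalarMeasure_eq hS₂ (hμ h) (ne_of_gt hz)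
    simp only [pullBack_sub, pullBack_smul] at h1
    rw [← hE z hz, smul_sub, ← sub_eq_zero]
    rw [← sub_eq_zero] at h1
    rw [← h1]
    abel
  -- Comparing the affine identity at `i` and `2i` isolates the linear coefficient.
  have hD : pullBack K₁ D₁ - pullBack K₂ D₂ = 0 := by
    have h1 := hlin Complex.I (by simp [upperHalf])
    have h2 := hlin (2 * Complex.I) (by simp [upperHalf])
    rw [h1, add_right_inj, mul_smul, two_smul, left_eq_add] at h2
    exact (smul_eq_zero.1 h2).resolve_left Complex.I_ne_zero
  refine ⟨fun δ hδ hb => ext_inner_self_right fun h => ?_, sub_eq_zero.1 hD, ?_⟩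
  · have h1 := form_pullBack_sub_form_pullBack hS₁ hS₂ hE h hδ hb
    rw [hE0 h, zero_div, zero_mul, sub_eq_zero] at h1
    rw [← OperatorMeasure.coe_form _ h hδ hb, ← OperatorMeasure.coe_form _ h hδ hb, h1]
  · rw [hlin Complex.I (by simp [upperHalf]), hD, smul_zero, add_zero]

end Conclusion

/-! ### The main theorem: elimination of `Im E` under each condition. -/

theorem corollary3p2
    {H H₁ H₂ : Type*}
    [NormedAddCommGroup H] [InnerProductSpace ℂ H] [CompleteSpace H]
    [NormedAddCommGroup H₁] [InnerProductSpace ℂ H₁] [CompleteSpace H₁]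
    [TopologicalSpace.SeparableSpace H₁]
    [NormedAddCommGroup H₂] [InnerProductSpace ℂ H₂] [CompleteSpace H₂]
    [TopologicalSpace.SeparableSpace H₂]
    (F₁ : ℂ → H₁ →L[ℂ] H₁) (F₂ : ℂ → H₂ →L[ℂ] H₂)
    (hF₁ : IsRFunction F₁) (hF₂ : IsRFunction F₂)
    (C₁ D₁ B₁ : H₁ →L[ℂ] H₁) (S₁ : OperatorMeasure H₁)
    (C₂ D₂ B₂ : H₂ →L[ℂ] H₂) (S₂ : OperatorMeasure H₂)
    (hS₁ : IsSpectralData F₁ C₁ D₁ S₁) (hS₂ : IsSpectralData F₂ C₂ D₂ S₂)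
    (K₁ : H ≃L[ℂ] H₁) (K₂ : H ≃L[ℂ] H₂)
    (hΩ : (commonResolventPoints upperHalf F₁ B₁ F₂ B₂).Nonempty)
    (hEq : ∀ z ∈ commonResolventPoints upperHalf F₁ B₁ F₂ B₂,
      weylTransform F₁ B₁ K₁ z = weylTransform F₂ B₂ K₂ z)
    (hCond :
      (¬ S₁.acPart.EquivLebesgue ∧ ¬ S₂.acPart.EquivLebesgue) ∨
      ((commonResolventPoints lowerHalf F₁ B₁ F₂ B₂).Nonempty ∧
        ∀ z ∈ commonResolventPoints lowerHalf F₁ B₁ F₂ B₂,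
          weylTransform F₁ B₁ K₁ z = weylTransform F₂ B₂ K₂ z) ∨
      (∃ (t₀ : ℝ) (T : H →L[ℂ] H),
        HasWeakDerivAt (S₁.pullBack K₁).distribution T t₀ ∧
        HasWeakDerivAt (S₂.pullBack K₂).distribution T t₀)) :
    (S₁.pullBack K₁).Same (S₂.pullBack K₂) ∧
    ℑ (pullBack K₁ B₁) = ℑ (pullBack K₂ B₂) ∧
    pullBack K₁ C₁ - (ℜ (pullBack K₁ B₁) : H →L[ℂ] H) =
      pullBack K₂ C₂ - (ℜ (pullBack K₂ B₂) : H →L[ℂ] H) ∧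
    pullBack K₁ D₁ = pullBack K₂ D₂ := by
  have hE : ∀ z ∈ upperHalf, pullBack K₁ (F₁ z) - pullBack K₂ (F₂ z) =
      pullBack K₁ B₁ - pullBack K₂ B₂ := fun z hz =>
    pullBack_sub_eq_on isOpen_upperHalf isPreconnected_upperHalf
      (hF₁.holomorphic.mono fun w hw => ne_of_gt hw) (hF₂.holomorphic.mono fun w hw => ne_of_gt hw)
      hΩ hEq hz
  have hform := fun (h : H) (δ : Set ℝ) (hδ : MeasurableSet δ) (hb : Bornology.IsBounded δ) =>
    form_pullBack_sub_form_pullBack hS₁ hS₂ hE h hδ hb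
  have hE0 : ∀ h, (inner ℂ h ((pullBack K₁ B₁ - pullBack K₂ B₂) h)).im = 0 := by
    rcases hCond with ⟨h₁, h₂⟩ | ⟨hΩ', hEq'⟩ | ⟨t₀, T, h₁, h₂⟩
    · intro h
      obtain ⟨α, hα, hαb, hαv, hα0⟩ := S₁.exists_eq_zero_of_not_equivLebesgue h₁
      obtain ⟨β, hβ, hβb, hβv, hβ0⟩ := S₂.exists_eq_zero_of_not_equivLebesgue h₂
      -- The null set of `S₂` gives one sign of the constant; exchanging the roles of the two
      -- measures gives the other.
      have h3 := nonneg_of_form_sub_form_eq (hform h) hβ hβb hβv (by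
        ext x
        simp [OperatorMeasure.pullBack, OperatorMeasure.conj, hβ0])
      have h4 := nonneg_of_form_sub_form_eq (S := S₂.pullBack K₂) (T := S₁.pullBack K₁) (g := h)
        (h := h) (c := -((inner ℂ h ((pullBack K₁ B₁ - pullBack K₂ B₂) h)).im / Real.pi))
        (fun δ hδ hb => by rw [neg_mul, ← hform h δ hδ hb, neg_sub]) hα hαb hαv (by
          ext x
          simp [OperatorMeasure.pullBack, OperatorMeasure.conj, hα0])
      exact (div_eq_zero_iff.1 (le_antisymm (neg_nonneg.1 h4) h3)).resolve_right Real.pi_ne_zero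
    · have hI : Complex.I ∈ upperHalf := by simp [upperHalf]
      have hI' : -Complex.I ∈ lowerHalf := by simp [lowerHalf]
      have h3 := pullBack_sub_eq_on isOpen_lowerHalf isPreconnected_lowerHalf
        (hF₁.holomorphic.mono fun w hw => ne_of_lt hw)
        (hF₂.holomorphic.mono fun w hw => ne_of_lt hw) hΩ' hEq' hI'
      have hstar : star Complex.I = -Complex.I := Complex.conj_I
      -- Taking adjoints carries the difference at `i` to the difference at `-i`, and both equal the
      -- same operator.
      have h4 : IsSelfAdjoint (pullBack K₁ B₁ - pullBack K₂ B₂) := by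
        rw [← hE _ hI, isSelfAdjoint_iff, star_sub, ContinuousLinearMap.star_eq_adjoint,
          ContinuousLinearMap.star_eq_adjoint, adjoint_pullBack, adjoint_pullBack,
          hF₁.symm _ (by simp), hF₂.symm _ (by simp), hstar, h3, hE _ hI]
      exact fun h => h4.isSymmetric.im_inner_self_apply h
    · intro h
      exact (div_eq_zero_iff.1 (eq_zero_of_hasWeakDerivAt (hform h) h₁ h₂)).resolve_right
        Real.pi_ne_zero
  obtain ⟨hS, hD, hC⟩ := pullBack_spectralData_eq hS₁ hS₂ hE hE0
  -- The constant equals the difference of the self-adjoint operators `C̃_j`, so its imaginary part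
  -- vanishes and its real part is the whole of it.
  have hsa : IsSelfAdjoint (pullBack K₁ B₁ - pullBack K₂ B₂) := by
    rw [← hC, isSelfAdjoint_iff, star_sub, ContinuousLinearMap.star_eq_adjoint,
      ContinuousLinearMap.star_eq_adjoint, adjoint_pullBack, adjoint_pullBack,
      hS₁.selfAdjoint.adjoint_eq, hS₂.selfAdjoint.adjoint_eq]
  refine ⟨hS, ?_, ?_, hD⟩
  · rw [← sub_eq_zero, ← map_sub, hsa.imaginaryPart]
  · rw [sub_eq_sub_iff_sub_eq_sub, hC, ← hsa.coe_realPart, map_sub]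
    simp
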